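/- **Theorem 4.1.** Let $(X,d)$ be a metric space, let $\widetilde X$ be its completion (with metric again denoted $d$), and let $u,v\in X$. A *$uv$-geodesic* is an isometric map $\gamma:[0,d(u,v)]\to\widetilde X$ with $\gamma(0)=u$ and $\gamma(d(u,v))=v$. Points $x_0,\dots,x_m$ are said to *lie on $\gamma$ in this order* if $x_i=\gamma(t_i)$ for some $t_0\le t_1\le\dots\le t_m$ in $[0,d(u,v)]$. Suppose that an infinite set $\mathcal M$ of $uv$-geodesics, called *marked*, and a constant $c>0$ are given such that the following holds. For any two distinct points $u_0,v_0$ lying in this order on a marked $uv$-geodesic, there are $n\in\mathbb N$ and points $w_0=u_0,w_1,\dots,w_{n-1},w_n=v_0$ in $\widetilde X$ which lie in this order on some marked $uv$-geodesic, and points $z_1,\dots,z_n,\widetilde z_1,\dots,\widetilde z_n\in\widetilde X$, such that (a) $w_0,z_1,w_1,z_2,\dots,w_{n-1},z_n,w_n$ lie in this order on some marked $uv$-geodesic; (b) $w_0,\widetilde z_1,w_1,\widetilde z_2,\dots,w_{n-1},\widetilde z_n,w_n$ lie in this order on some marked $uv$-geodesic; (c) $d(w_i,z_i)=d(w_i,\widetilde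 z_i)$ and $d(w_{i-1},z_i)=d(w_{i-1},\widetilde z_i)$ for $i=1,\dots,n$; (d) $\sum_{i=1}^n d(z_i,\widetilde z_i)\ge c\,d(u_0,v_0)$. Then $X$ does not admit a bilipschitz embedding into any Banach space with the Radon–Nikodým property. That is, if $Y$ is a Banach space such that for every finite measure space $(\Omega,\Sigma,\mu)$, every countably additive $\mu$-continuous measure $\nu:\Sigma\to Y$ of bounded variation has the form $\nu(A)=\int_A g\,d\mu$ $(A\in\Sigma)$ for some Bochner integrable $g:\Omega\to Y$, then there are no map $f:X\to Y$ and constants $0<\alpha\le\beta<\infty$ with $\alpha\,d(x,y)\le\|f(x)-f(y)\|\le\beta\,d(x,y)$ for all $x,y\in X$. -/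

import Mathlib

universe w x y

open MeasureTheory

/-- A Banach space `Y` has the Radon-Nikodym property if for every finite measure space `(Ω, μ)`,
every countably additive `Y`-valued measure `ν` on `Ω` of bounded variation that vanishes on
`μ`-null sets has a Bochner integrable density with respect to `μ`. -/
def HasRNP (Y : Type y) [NormedAddCommGroup Y] [NormedSpace ℝ Y] [CompleteSpace Y] : Prop :=
  ∀ (Ω : Type w) [MeasurableSpace Ω] (μ : Measure Ω) [IsFiniteMeasure μ] (ν : VectorMeasure Ω Y),
    ν.variation Set.univ < ⊤ →
    (∀ A : Set Ω, MeasurableSet A → μ A = 0 → ν A = 0) →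
    ∃ g : Ω → Y, Integrable g μ ∧ ∀ A : Set Ω, MeasurableSet A → ν A = ∫ ω in A, g ω ∂μ

/-- `f` is a bilipschitz embedding. -/
def IsBilipschitzEmbedding {X : Type x} {Y : Type y} [MetricSpace X] [MetricSpace Y]
    (f : X → Y) : Prop :=
  ∃ a b : ℝ, 0 < a ∧ 0 < b ∧
    ∀ p q : X, a * dist p q ≤ dist (f p) (f q) ∧ dist (f p) (f q) ≤ b * dist p q

/-- A geodesic from `p` to `q` in a metric space `P` (a `pq`-geodesic), parametrized by the
distance to `p`. As the domain is exactly `[0, d(p,q)]`, two such objects are equal if and only if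
they are the same curve. -/
structure Geodesic {P : Type x} [MetricSpace P] (p q : P) where
  toFun : Set.Icc (0 : ℝ) (dist p q) → P
  isometry : Isometry toFun
  source : toFun ⟨0, le_refl 0, dist_nonneg⟩ = p
  target : toFun ⟨dist p q, dist_nonneg, le_refl (dist p q)⟩ = q

namespace Geodesic

variable {P : Type x} [MetricSpace P] {p q : P}

/-- The points `a 0, a 1, …` lie on `γ` and are listed in their order on `γ`
(repetitions are allowed). -/
def Visits (γ : Geodesic p q) {m : ℕ} (a : Fin m → P) : Prop :=
  ∃ τ : Fin m → Set.Icc (0 : ℝ) (dist p q), Monotone τ ∧ ∀ i, γ.toFun (τ i) = a i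

/-- The points `w 0, z 0, w 1, z 1, …, w (n-1), z (n-1), w n` lie on `γ` and are listed in their
order on `γ` (repetitions are allowed). -/
def VisitsInterleaved (γ : Geodesic p q) {n : ℕ} (w : Fin (n + 1) → P) (z : Fin n → P) : Prop :=
  ∃ (σ : Fin (n + 1) → Set.Icc (0 : ℝ) (dist p q)) (τ : Fin n → Set.Icc (0 : ℝ) (dist p q)),
    (∀ i, γ.toFun (σ i) = w i) ∧ (∀ i, γ.toFun (τ i) = z i) ∧
      ∀ i : Fin n, σ i.castSucc ≤ τ i ∧ τ i ≤ σ i.succ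

end Geodesic

/-- The thickness condition, with constant `c`, on a family `M` of marked `uv`-geodesics: it is
required of any two points `u₀ = γ s`, `v₀ = γ t`, in this order, on a marked geodesic `γ`.
The point `z i`, `i = 0, …, n - 1`, is the one between `w i` and `w (i + 1)`. -/
def IsThickFamily {P : Type x} [MetricSpace P] {u v : P} (M : Set (Geodesic u v)) (c : ℝ) : Prop :=
  ∀ γ ∈ M, ∀ s t : Set.Icc (0 : ℝ) (dist u v), s < t →
    ∃ (n : ℕ) (w : Fin (n + 1) → P) (z z' : Fin n → P),
      w 0 = γ.toFun s ∧ w (Fin.last n) = γ.toFun t ∧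
      (∃ η ∈ M, η.Visits w) ∧
      (∃ η ∈ M, η.VisitsInterleaved w z) ∧
      (∃ η ∈ M, η.VisitsInterleaved w z') ∧
      (∀ i : Fin n, dist (w i.succ) (z i) = dist (w i.succ) (z' i) ∧
        dist (w i.castSucc) (z i) = dist (w i.castSucc) (z' i)) ∧
      c * dist (γ.toFun s) (γ.toFun t) ≤ ∑ i : Fin n, dist (z i) (z' i)

/-! A Lipschitz curve in a space with the Radon–Nikodým property has an integrable derivative, so in
the mean it is almost affine at small scales: its total deviation from chords tends to zero with the
mesh (`HasRNP.exists_not_zigzag`). Thickness produces a curve whose image violates this. Extend the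
embedding f to the completion. Two marked geodesics that share the points w_i but pass through z_i
and z̃_i at equal parameters have images whose chord deviations differ by f(z_i) − f(z̃_i). Hence
one of the two images deviates by a total proportional to the length of the arc
(`IsThickFamily.zigzagReplacement`). Replacing short arcs in this way moves a spliced curve only
slightly, so zigzags of any given mesh occur densely among limits of spliced curves. They survive
small perturbations, and Baire's theorem yields one 1-Lipschitz curve with zigzags of every mesh
(`exists_curve_zigzag`). -/

/-! ### Chord deviations and zigzags -/

section Zigzag

variable {Y : Type*} [NormedAddCommGroup Y] [NormedSpace ℝ Y]

/-- The deviation at `z` of `F` from its chord over `[a, b]`. -/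
noncomputable def chordDeviation (F : ℝ → Y) (a z b : ℝ) : Y :=
  F z - F a - ((z - a) / (b - a)) • (F b - F a)

/-- `Zigzag δ F a b κ`: the interval `[a, b]` is divided into pieces of length at most `δ`, in each
of which a point is chosen, such that the deviations of `F` at these points from its chords over
the pieces add up to at least `κ`. -/
inductive Zigzag (δ : ℝ) (F : ℝ → Y) : ℝ → ℝ → ℝ → Prop
  | single {a z b κ : ℝ} (haz : a ≤ z) (hzb : z ≤ b) (hδ : b - a ≤ δ)
      (hκ : κ ≤ ‖chordDeviation F a z b‖) : Zigzag δ F a b κ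
  | trans {a b c κ κ' : ℝ} : Zigzag δ F a b κ → Zigzag δ F b c κ' → Zigzag δ F a c (κ + κ')

lemma chord_ratio_mem {a z b : ℝ} (haz : a ≤ z) (hzb : z ≤ b) :
    0 ≤ (z - a) / (b - a) ∧ (z - a) / (b - a) ≤ 1 :=
  ⟨div_nonneg (by linarith) (by linarith), div_le_one_of_le₀ (by linarith) (by linarith)⟩

lemma norm_smul_le_of_mem_unit {r : ℝ} (h : 0 ≤ r ∧ r ≤ 1) (y : Y) : ‖r • y‖ ≤ ‖y‖ := by
  rw [norm_smul, Real.norm_of_nonneg h.1]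
  exact mul_le_of_le_one_left (norm_nonneg _) h.2

lemma norm_chordDeviation_sub_le {F G : ℝ → Y} {a z b ρ : ℝ} (haz : a ≤ z) (hzb : z ≤ b)
    (h : ∀ r ∈ Set.Icc a b, ‖F r - G r‖ ≤ ρ) :
    ‖chordDeviation F a z b - chordDeviation G a z b‖ ≤ 4 * ρ := by
  have ha := h a ⟨le_rfl, haz.trans hzb⟩
  have hb := h b ⟨haz.trans hzb, le_rfl⟩
  have hz := h z ⟨haz, hzb⟩
  have e : chordDeviation F a z b - chordDeviation G a z b =
      (F z - G z) - (F a - G a) - ((z - a) / (b - a)) • ((F b - G b) - (F a - G a)) := by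
    simp only [chordDeviation, smul_sub]; abel
  rw [e]
  have h1 := norm_smul_le_of_mem_unit (chord_ratio_mem haz hzb) ((F b - G b) - (F a - G a))
  have h2 := norm_sub_le (F b - G b) (F a - G a)
  have h3 := norm_sub_le (F z - G z) (F a - G a)
  have h4 := norm_sub_le ((F z - G z) - (F a - G a))
    (((z - a) / (b - a)) • ((F b - G b) - (F a - G a)))
  linarith

namespace Zigzag

variable {δ : ℝ} {F G : ℝ → Y} {a b κ κ' : ℝ}

lemma le (h : Zigzag δ F a b κ) : a ≤ b := by
  induction h with
  | single h1 h2 => exact h1.trans h2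
  | trans _ _ h1 h2 => exact h1.trans h2

lemma congr (h : Zigzag δ F a b κ) (hFG : Set.EqOn F G (Set.Icc a b)) : Zigzag δ G a b κ := by
  induction h with
  | single h1 h2 h3 h4 =>
    refine single h1 h2 h3 (h4.trans_eq ?_)
    rw [chordDeviation, chordDeviation, hFG ⟨h1, h2⟩, hFG ⟨le_rfl, h1.trans h2⟩,
      hFG ⟨h1.trans h2, le_rfl⟩]
  | trans h1 h2 ih1 ih2 =>
    exact (ih1 (hFG.mono (Set.Icc_subset_Icc_right h2.le))).trans
      (ih2 (hFG.mono (Set.Icc_subset_Icc_left h1.le)))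

lemma mono (h : Zigzag δ F a b κ) {δ' : ℝ} (hδ : δ ≤ δ') : Zigzag δ' F a b κ := by
  induction h with
  | single h1 h2 h3 h4 => exact single h1 h2 (h3.trans hδ) h4
  | trans _ _ ih1 ih2 => exact ih1.trans ih2

lemma of_le (h : Zigzag δ F a b κ) (hκ : κ' ≤ κ) : Zigzag δ F a b κ' := by
  induction h generalizing κ' with
  | single h1 h2 h3 h4 => exact single h1 h2 h3 (hκ.trans h4)
  | @trans a b c κ₁ κ₂ h1 _ _ ih =>
    -- The second part absorbs the whole reduction; sizes may be negative.
    have := h1.trans (ih (κ' := κ' - κ₁) (by linarith))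
    rwa [add_sub_cancel] at this

/-- A zigzag survives small uniform perturbations. -/
lemma exists_perturb (h : Zigzag δ F a b κ) :
    ∀ ε > 0, ∃ ρ > 0, ∀ G : ℝ → Y, (∀ r ∈ Set.Icc a b, ‖F r - G r‖ ≤ ρ) →
      Zigzag δ G a b (κ - ε) := by
  induction h with
  | @single a z b κ h1 h2 h3 h4 =>
    intro ε hε
    refine ⟨ε / 4, by positivity, fun G hG ↦ single h1 h2 h3 ?_⟩
    have h5 := norm_chordDeviation_sub_le h1 h2 hG
    have h6 := norm_le_norm_add_norm_sub (chordDeviation G a z b) (chordDeviation F a z b)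
    rw [norm_sub_rev] at h5
    linarith
  | trans h1 h2 ih1 ih2 =>
    intro ε hε
    obtain ⟨ρ, hρ, H⟩ := ih1 (ε / 2) (by positivity)
    obtain ⟨ρ', hρ', H'⟩ := ih2 (ε / 2) (by positivity)
    refine ⟨min ρ ρ', lt_min hρ hρ', fun G hG ↦ ?_⟩
    have := (H G fun r hr ↦ (hG r ⟨hr.1, hr.2.trans h2.le⟩).trans (min_le_left _ _)).trans
      (H' G fun r hr ↦ (hG r ⟨h1.le.trans hr.1, hr.2⟩).trans (min_le_right _ _))
    convert this using 1
    ring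

lemma of_chain {n : ℕ} {σ : Fin (n + 1) → ℝ} {τ : Fin n → ℝ}
    (h : ∀ i : Fin n, σ i.castSucc ≤ τ i ∧ τ i ≤ σ i.succ) (hδ : σ (Fin.last n) - σ 0 ≤ δ) :
    Zigzag δ F (σ 0) (σ (Fin.last n))
      (∑ i : Fin n, ‖chordDeviation F (σ i.castSucc) (τ i) (σ i.succ)‖) := by
  have hmono : Monotone σ := Fin.monotone_iff_le_succ.2 fun i ↦ (h i).1.trans (h i).2
  induction n with
  | zero => exact single le_rfl le_rfl hδ (by simp)
  | succ n ih =>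
    have h1 := ih (σ := σ ∘ Fin.castSucc) (τ := τ ∘ Fin.castSucc) (fun i ↦ h i.castSucc)
      (le_trans (sub_le_sub_right (hmono (Fin.le_last _)) _) hδ)
      (hmono.comp Fin.strictMono_castSucc.monotone)
    have h2 : Zigzag δ F (σ (Fin.last n).castSucc) (σ (Fin.last n).succ) _ :=
      single (h (Fin.last n)).1 (h (Fin.last n)).2
        (le_trans (sub_le_sub_left (hmono (Fin.zero_le _)) _) hδ) le_rfl
    rw [Fin.sum_univ_castSucc]
    exact h1.trans h2

end Zigzag

end Zigzag

/-! ### Spliced curves and their refinement -/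

section Spliced

variable {P : Type*}

/-- A curve over `[a, b]` obtained by joining end to end finitely many arcs of curves in `S`. -/
inductive Spliced (S : Set (ℝ → P)) : ℝ → ℝ → (ℝ → P) → Prop
  | single {a b : ℝ} {γ η : ℝ → P} (hab : a ≤ b) (hη : η ∈ S) (h : Set.EqOn γ η (Set.Icc a b)) :
      Spliced S a b γ
  | trans {a b c : ℝ} {γ : ℝ → P} : Spliced S a b γ → Spliced S b c γ → Spliced S a c γ

namespace Spliced

variable {S : Set (ℝ → P)} {a b c D : ℝ} {γ γ' : ℝ → P}

lemma le (h : Spliced S a b γ) : a ≤ b := by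
  induction h with
  | single h => exact h
  | trans _ _ h1 h2 => exact h1.trans h2

lemma congr (h : Spliced S a b γ) (hγ : Set.EqOn γ γ' (Set.Icc a b)) : Spliced S a b γ' := by
  induction h with
  | single h1 h2 h3 => exact single h1 h2 (hγ.symm.trans h3)
  | trans h1 h2 ih1 ih2 =>
    exact (ih1 (hγ.mono (Set.Icc_subset_Icc_right h2.le))).trans
      (ih2 (hγ.mono (Set.Icc_subset_Icc_left h1.le)))

lemma dist_le [MetricSpace P]
    (hS : ∀ η ∈ S, ∀ r s, 0 ≤ r → r ≤ s → s ≤ D → dist (η r) (η s) ≤ s - r)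
    (h : Spliced S a b γ) (ha : 0 ≤ a) (hb : b ≤ D) :
    ∀ r s, a ≤ r → r ≤ s → s ≤ b → dist (γ r) (γ s) ≤ s - r := by
  induction h with
  | single h1 h2 h3 =>
    intro r s hr hrs hs
    rw [h3 ⟨hr, hrs.trans hs⟩, h3 ⟨hr.trans hrs, hs⟩]
    exact hS _ h2 r s (ha.trans hr) hrs (hs.trans hb)
  | @trans a b c γ h1 h2 ih1 ih2 =>
    intro r s hr hrs hs
    have k1 := ih1 ha (h2.le.trans hb)
    have k2 := ih2 (ha.trans h1.le) hb
    rcases le_total s b with hsb | hsb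
    · exact k1 r s hr hrs hsb
    rcases le_total b r with hbr | hbr
    · exact k2 r s hbr hrs hs
    · have := k1 r b hr hbr le_rfl
      have := k2 b s le_rfl hsb hs
      have := dist_triangle (γ r) (γ b) (γ s)
      linarith

end Spliced

variable [MetricSpace P] {Y : Type*} [NormedAddCommGroup Y] [NormedSpace ℝ Y]

/-- There is a spliced curve over `[a, b]` which has the same endpoints as `γ`, is `2δ`-close to
it, and has an image under `f` with a zigzag of mesh `δ` and size proportional to `b - a`. -/
def HasZigzagRefinement (S : Set (ℝ → P)) (f : P → Y) (κ δ a b : ℝ) (γ : ℝ → P) : Prop :=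
  ∃ γ', Spliced S a b γ' ∧ γ' a = γ a ∧ γ' b = γ b ∧
    (∀ r ∈ Set.Icc a b, dist (γ r) (γ' r) ≤ 2 * δ) ∧
    Zigzag δ (f ∘ γ') a b (κ * (b - a))

variable {S : Set (ℝ → P)} {f : P → Y} {κ δ a b c D : ℝ} {γ : ℝ → P}

lemma HasZigzagRefinement.trans (h1 : HasZigzagRefinement S f κ δ a b γ)
    (h2 : HasZigzagRefinement S f κ δ b c γ) : HasZigzagRefinement S f κ δ a c γ := by
  obtain ⟨γ₁, s₁, a₁, b₁, d₁, z₁⟩ := h1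
  obtain ⟨γ₂, s₂, a₂, b₂, d₂, z₂⟩ := h2
  set γ' : ℝ → P := fun r ↦ if r ≤ b then γ₁ r else γ₂ r with hγ'
  have e₁ : Set.EqOn γ₁ γ' (Set.Icc a b) := fun r hr ↦ by simp [hγ', hr.2]
  have e₂ : Set.EqOn γ₂ γ' (Set.Icc b c) := fun r hr ↦ by
    rcases hr.1.eq_or_lt with rfl | h
    · simp [hγ', a₂, b₁]
    · simp [hγ', h]
  refine ⟨γ', (s₁.congr e₁).trans (s₂.congr e₂), ?_, ?_, fun r hr ↦ ?_, ?_⟩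
  · rw [← e₁ ⟨le_rfl, s₁.le⟩, a₁]
  · rw [← e₂ ⟨s₂.le, le_rfl⟩, b₂]
  · rcases le_total r b with h | h
    · rw [← e₁ ⟨hr.1, h⟩]; exact d₁ r ⟨hr.1, h⟩
    · rw [← e₂ ⟨h, hr.2⟩]; exact d₂ r ⟨h, hr.2⟩
  · have := (z₁.congr (G := f ∘ γ') fun r hr ↦ congrArg f (e₁ hr)).trans
      (z₂.congr (G := f ∘ γ') fun r hr ↦ congrArg f (e₂ hr))
    convert this using 1
    ring

/-- Any arc of a curve in `S` can be replaced by an arc of another curve in `S` with the same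
endpoints, whose image under `f` has a zigzag of size proportional to the length of the arc. -/
def ZigzagReplacement (S : Set (ℝ → P)) (f : P → Y) (κ D : ℝ) : Prop :=
  ∀ η ∈ S, ∀ a b, 0 ≤ a → a < b → b ≤ D → ∃ η' ∈ S, η' a = η a ∧ η' b = η b ∧
    Zigzag (b - a) (f ∘ η') a b (κ * (b - a))

/-- Each arc is cut into pieces of length at most δ, and the replacement is applied to every piece.
On a piece, the old and the new curve start at the same point and are 1-Lipschitz, so they stay
within 2δ of each other. -/
lemma Spliced.hasZigzagRefinement
    (hS : ∀ η ∈ S, ∀ r s, 0 ≤ r → r ≤ s → s ≤ D → dist (η r) (η s) ≤ s - r)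
    (hR : ZigzagReplacement S f κ D) (h : Spliced S a b γ) (ha : 0 ≤ a) (hb : b ≤ D)
    (hδ : 0 < δ) : HasZigzagRefinement S f κ δ a b γ := by
  induction h with
  | trans h1 h2 ih1 ih2 => exact (ih1 ha (h2.le.trans hb)).trans (ih2 (ha.trans h1.le) hb)
  | @single a b γ η hab hη he =>
    obtain ⟨n, hn⟩ := exists_nat_ge ((b - a) / δ)
    rw [div_le_iff₀ hδ] at hn
    induction n generalizing a with
    | zero =>
      obtain rfl : a = b := by simp at hn; linarith
      refine ⟨γ, .single le_rfl hη he, rfl, rfl, fun r _ ↦ by simp [hδ.le], ?_⟩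
      exact .single le_rfl le_rfl (by simpa using hδ.le) (by simp)
    | succ n ih =>
      have key (a b : ℝ) (ha : 0 ≤ a) (hab : a < b) (hb : b ≤ D) (hδ : b - a ≤ δ)
          (he : Set.EqOn γ η (Set.Icc a b)) : HasZigzagRefinement S f κ δ a b γ := by
        obtain ⟨η', hη', ea, eb, hz⟩ := hR η hη a b ha hab hb
        have ea' : η a = γ a := (he ⟨le_rfl, hab.le⟩).symm
        have eb' : η b = γ b := (he ⟨hab.le, le_rfl⟩).symm
        refine ⟨η', .single hab.le hη' fun _ _ ↦ rfl, ea.trans ea', eb.trans eb', ?_, hz.mono hδ⟩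
        intro r hr
        rw [he hr]
        have h1 := hS η hη a r ha hr.1 (hr.2.trans hb)
        have h2 := hS η' hη' a r ha hr.1 (hr.2.trans hb)
        rw [ea] at h2
        have := dist_triangle_left (η r) (η' r) (η a)
        linarith [hr.2]
      rcases le_or_gt (b - a) δ with h | h
      · rcases hab.eq_or_lt with rfl | hab
        · exact ih le_rfl he ha (by rw [sub_self]; positivity)
        · exact key a b ha hab hb h he
      · refine (key a (a + δ) ha (by linarith) (by linarith) (by linarith)
          (he.mono (Set.Icc_subset_Icc_right (by linarith)))).trans
          (ih (by linarith) (he.mono (Set.Icc_subset_Icc_left (by linarith))) (by linarith) ?_)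
        push_cast at hn
        linarith

end Spliced

/-! ### Consequences of the Radon–Nikodým property -/

/-- Lipschitz curves in a space with the Radon-Nikodym property are primitives of integrable
functions. -/
lemma HasRNP.exists_density {Y : Type y} [NormedAddCommGroup Y] [NormedSpace ℝ Y] [CompleteSpace Y]
    (hY : HasRNP.{w} Y) {F : ℝ → Y} {D L : ℝ} (hD : 0 ≤ D)
    (hF : ∀ s t, 0 ≤ s → s ≤ t → t ≤ D → ‖F t - F s‖ ≤ L * (t - s)) :
    ∃ g : ℝ → Y, Integrable g ∧
      ∀ s t, 0 ≤ s → s ≤ t → t ≤ D → F t - F s = ∫ r in s..t, g r := by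
  -- Freezing F outside [0, D] makes its increments over all intervals dominated by the finite
  -- measure μ, so they extend to a vector measure.
  set p : ℝ → ℝ := fun t ↦ (Set.projIcc 0 D hD t : ℝ) with hp
  have hp0 (t) : 0 ≤ p t := (Set.projIcc 0 D hD t).2.1
  have hpD (t) : p t ≤ D := (Set.projIcc 0 D hD t).2.2
  have hpid {t} (h0 : 0 ≤ t) (h1 : t ≤ D) : p t = t := by
    simp [hp, Set.projIcc_of_mem hD ⟨h0, h1⟩]
  have hpm : Monotone p := fun s t h ↦ Set.monotone_projIcc hD h
  set μ : Measure ℝ := ENNReal.ofReal L • volume.restrict (Set.Icc 0 D) with hμ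
  have : IsFiniteMeasure μ := by
    rw [hμ]; exact Measure.smul_finite _ ENNReal.ofReal_ne_top
  have hbound (s) (hs : s ∈ {s | ∃ u v : ℝ, u ≤ v ∧ s = Set.Ioc u v}) :
      ‖AddContent.onIoc (F ∘ p) s‖ₑ ≤ μ s := by
    obtain ⟨u, v, huv, rfl⟩ := hs
    rw [AddContent.onIoc_apply huv]
    have h1 : ‖(F ∘ p) v - (F ∘ p) u‖ ≤ L * (p v - p u) := hF _ _ (hp0 _) (hpm huv) (hpD _)
    have h2 : Set.Ioc (p u) (p v) ⊆ Set.Ioc u v ∩ Set.Icc 0 D := by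
      rintro r ⟨hr, hr'⟩
      have hrD := hr'.trans (hpD _)
      have hr0 := (hp0 u).trans hr.le
      have e := hpid hr0 hrD
      refine ⟨⟨?_, ?_⟩, hr0, hrD⟩
      · by_contra! h
        have := hpm h
        linarith
      · rcases le_total v D with hv | hv
        · rcases le_total 0 v with hv' | hv'
          · rwa [hpid hv' hv] at hr'
          · have := hpm hv'
            rw [hpid le_rfl hD] at this
            linarith [hp0 u]
        · linarith
    calc ‖(F ∘ p) v - (F ∘ p) u‖ₑ ≤ ENNReal.ofReal (L * (p v - p u)) := by
          rw [← ofReal_norm]; exact ENNReal.ofReal_le_ofReal h1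
      _ = ENNReal.ofReal L * volume (Set.Ioc (p u) (p v)) := by
          rw [Real.volume_Ioc, ENNReal.ofReal_mul' (by linarith [hpm huv])]
      _ ≤ μ (Set.Ioc u v) := by
          rw [hμ, Measure.smul_apply, Measure.restrict_apply measurableSet_Ioc, smul_eq_mul]
          gcongr
  obtain ⟨ν, hν, hνμ⟩ := VectorMeasure.exists_extension_of_isSetSemiring_of_le_measure_of_generateFrom
    (μ := μ) IsSetSemiring.Ioc hbound (by
      rw [BorelSpace.measurable_eq (α := ℝ), borel_eq_generateFrom_Ioc_le]
      simp only [eq_comm])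
  -- The property is assumed for measure spaces in universe w only.
  let e : ULift.{w} ℝ ≃ᵐ ℝ := MeasurableEquiv.ulift
  let μ' : Measure (ULift.{w} ℝ) := μ.map e.symm
  have : IsFiniteMeasure μ' := inferInstance
  let ν' : VectorMeasure (ULift.{w} ℝ) Y := ν.map e.symm
  have hle (A : Set (ULift.{w} ℝ)) (hA : MeasurableSet A) : ‖ν' A‖ₑ ≤ μ' A := by
    rw [VectorMeasure.map_apply _ e.symm.measurable hA, Measure.map_apply e.symm.measurable hA]
    exact hνμ _
  obtain ⟨g, hg, hgν⟩ := hY (ULift.{w} ℝ) μ' ν'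
    ((VectorMeasure.variation_le_of_forall_enorm_le hle _).trans_lt (measure_lt_top _ _))
    (fun A hA h0 ↦ by simpa [h0] using hle A hA)
  have hgint : Integrable (g ∘ e.symm) μ := (integrable_map_equiv e.symm g).1 hg
  have hgA (A : Set ℝ) (hA : MeasurableSet A) : ν A = ∫ r in A, g (e.symm r) ∂μ := by
    have h1 := hgν (e ⁻¹' A) (e.measurable hA)
    rw [VectorMeasure.map_apply _ e.symm.measurable (e.measurable hA),
      setIntegral_map_equiv] at h1
    simpa [← Set.preimage_comp] using h1
  refine ⟨(Set.Icc 0 D).indicator (fun r ↦ (ENNReal.ofReal L).toReal • g (e.symm r)), ?_, ?_⟩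
  · rw [integrable_indicator_iff measurableSet_Icc]
    -- For L ≤ 0 the measure μ is zero and says nothing about g, but then the density is zero.
    rcases le_or_gt L 0 with hL | hL
    · simp [ENNReal.ofReal_of_nonpos hL]
    · exact ((integrable_smul_measure (by simpa using hL) ENNReal.ofReal_ne_top).1 hgint).smul _
  · intro s t hs hst ht
    have h1 := hν _ ⟨s, t, hst, rfl⟩
    rw [AddContent.onIoc_apply hst, hgA _ measurableSet_Ioc] at h1
    simp only [Function.comp_apply, hpid hs (hst.trans ht), hpid (hs.trans hst) ht] at h1
    rw [← h1, intervalIntegral.integral_of_le hst, hμ, Measure.restrict_smul, integral_smul_measure,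
      setIntegral_indicator measurableSet_Icc, Measure.restrict_restrict measurableSet_Ioc,
      integral_smul]

/-- The size of a zigzag of a primitive of `g` is small if `g` is close in the mean to a function `h`
which varies little over the mesh. -/
lemma Zigzag.le_integral {Y : Type*} [NormedAddCommGroup Y] [NormedSpace ℝ Y] [CompleteSpace Y]
    {F g h : ℝ → Y} {δ D ε a b κ : ℝ} (hz : Zigzag δ F a b κ) (ha : 0 ≤ a) (hb : b ≤ D)
    (hg : Integrable g) (hh : Integrable h)
    (hF : ∀ s t, 0 ≤ s → s ≤ t → t ≤ D → F t - F s = ∫ r in s..t, g r)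
    (hδ : ∀ s t, |s - t| ≤ δ → ‖h s - h t‖ ≤ ε) :
    κ ≤ 2 * (∫ r in a..b, ‖g r - h r‖) + 2 * ε * (b - a) := by
  induction hz with
  | @trans a b c κ κ' h1 h2 ih1 ih2 =>
    have := ih1 ha (h2.le.trans hb)
    have := ih2 (ha.trans h1.le) hb
    have hi : Integrable fun r ↦ ‖g r - h r‖ := (hg.sub hh).norm
    rw [← intervalIntegral.integral_add_adjacent_intervals (b := b) hi.intervalIntegrable
      hi.intervalIntegrable]
    linarith
  | @single a z b κ haz hzb hab hκ =>
    -- Subtracting the constant h a from g changes F by an affine function, which has no chord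
    -- deviation.
    have hgc (s t : ℝ) : IntervalIntegrable (fun r ↦ g r - h a) volume s t :=
      hg.intervalIntegrable.sub intervalIntegrable_const
    have hinc (t) (h1 : a ≤ t) (h2 : t ≤ b) :
        F t - F a = (∫ r in a..t, (g r - h a)) + (t - a) • h a := by
      rw [hF a t ha h1 (h2.trans hb), intervalIntegral.integral_sub hg.intervalIntegrable
        intervalIntegrable_const, intervalIntegral.integral_const]
      abel
    have hrat : ((z - a) / (b - a)) * (b - a) = z - a := by
      rcases eq_or_ne (b - a) 0 with h0 | h0
      · rw [h0, mul_zero]; linarith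
      · field_simp
    have e : chordDeviation F a z b = (∫ r in a..z, (g r - h a)) -
        ((z - a) / (b - a)) • ∫ r in a..b, (g r - h a) := by
      rw [chordDeviation, hinc z haz hzb, hinc b (haz.trans hzb) le_rfl, smul_add, smul_smul, hrat]
      abel
    have hn (t) (h1 : a ≤ t) (h2 : t ≤ b) :
        ‖∫ r in a..t, (g r - h a)‖ ≤ (∫ r in a..b, ‖g r - h r‖) + ε * (b - a) := by
      have hi : IntervalIntegrable (fun r ↦ ‖g r - h r‖) volume a b :=
        (hg.sub hh).norm.intervalIntegrable
      calc ‖∫ r in a..t, (g r - h a)‖ ≤ ∫ r in a..t, ‖g r - h a‖ :=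
            intervalIntegral.norm_integral_le_integral_norm h1
        _ ≤ ∫ r in a..b, ‖g r - h a‖ := intervalIntegral.integral_mono_interval le_rfl h1 h2
            (.of_forall fun _ ↦ norm_nonneg _) (hgc a b).norm
        _ ≤ ∫ r in a..b, (‖g r - h r‖ + ε) := by
            refine intervalIntegral.integral_mono_on (h1.trans h2) (hgc a b).norm
              (hi.add intervalIntegrable_const) fun r hr ↦ ?_
            have := hδ r a (by rw [abs_of_nonneg] <;> linarith [hr.1, hr.2])
            have := norm_sub_le_norm_sub_add_norm_sub (g r) (h r) (h a)
            linarith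
        _ = _ := by
            rw [intervalIntegral.integral_add hi intervalIntegrable_const,
              intervalIntegral.integral_const, smul_eq_mul, mul_comm ε]
    have k1 := hn z haz hzb
    have k2 := hn b (haz.trans hzb) le_rfl
    have k3 := norm_smul_le_of_mem_unit (chord_ratio_mem haz hzb) (∫ r in a..b, (g r - h a))
    have k4 := norm_sub_le (∫ r in a..z, (g r - h a))
      (((z - a) / (b - a)) • ∫ r in a..b, (g r - h a))
    rw [e] at hκ
    linarith

/-- Lipschitz curves in a space with the Radon-Nikodym property have no zigzags of fixed size and
arbitrarily small mesh. -/
lemma HasRNP.exists_not_zigzag {Y : Type y} [NormedAddCommGroup Y] [NormedSpace ℝ Y]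
    [CompleteSpace Y] (hY : HasRNP.{w} Y) {F : ℝ → Y} {D L κ : ℝ} (hD : 0 < D) (hκ : 0 < κ)
    (hF : ∀ s t, 0 ≤ s → s ≤ t → t ≤ D → ‖F t - F s‖ ≤ L * (t - s)) :
    ∃ δ > 0, ¬ Zigzag δ F 0 D κ := by
  obtain ⟨g, hg, hgF⟩ := hY.exists_density hD.le hF
  -- With errors κ/8 in the mean and κ/(8D) pointwise, a zigzag has size at most κ/4 + κ/4 < κ.
  obtain ⟨h, hc, hgh, hcont, hh⟩ :=
    hg.exists_hasCompactSupport_integral_sub_le (ε := κ / 8) (by positivity)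
  have hu : UniformContinuous h := hcont.uniformContinuous_of_tendsto_cocompact hc.is_zero_at_infty
  obtain ⟨δ, hδ, H⟩ := Metric.uniformContinuous_iff.1 hu (κ / (8 * D)) (by positivity)
  refine ⟨δ / 2, by positivity, fun hz ↦ ?_⟩
  have h1 := hz.le_integral (ε := κ / (8 * D)) le_rfl le_rfl hg hh hgF fun s t hst ↦ by
    rw [← dist_eq_norm]
    exact (H (by rw [Real.dist_eq]; linarith)).le
  have h2 : ∫ r in (0 : ℝ)..D, ‖g r - h r‖ ≤ ∫ r, ‖g r - h r‖ := by
    rw [intervalIntegral.integral_of_le hD.le]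
    exact setIntegral_le_integral (hg.sub hh).norm (.of_forall fun _ ↦ norm_nonneg _)
  have h3 : 2 * (κ / (8 * D)) * (D - 0) = κ / 4 := by field_simp; ring
  linarith

/-! ### Baire category argument -/

section Baire

variable {P : Type*} [MetricSpace P] {Y : Type*} [NormedAddCommGroup Y] [NormedSpace ℝ Y]
  {S : Set (ℝ → P)} {f : P → Y} {κ D : ℝ}

/-- A generic limit of spliced curves has zigzags of arbitrarily small mesh. -/
lemma exists_curve_zigzag [CompleteSpace P] (hf : UniformContinuous f) (hD : 0 ≤ D)
    (hS : ∀ η ∈ S, ∀ r s, 0 ≤ r → r ≤ s → s ≤ D → dist (η r) (η s) ≤ s - r)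
    (hR : ZigzagReplacement S f κ D) (hne : S.Nonempty) {κ' : ℝ} (hκ' : κ' < κ * D) :
    ∃ γ : ℝ → P, (∀ r s, 0 ≤ r → r ≤ s → s ≤ D → dist (γ r) (γ s) ≤ s - r) ∧
      ∀ δ > 0, Zigzag δ (f ∘ γ) 0 D κ' := by
  let Z : Set C(Set.Icc (0 : ℝ) D, P) := {φ | ∃ γ, Spliced S 0 D γ ∧ ∀ r, φ r = γ r}
  let ext (φ : C(Set.Icc (0 : ℝ) D, P)) : ℝ → P := fun r ↦ φ (Set.projIcc 0 D hD r)
  have hext {φ : C(Set.Icc (0 : ℝ) D, P)} {γ : ℝ → P} (h : ∀ r, φ r = γ r) :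
      Set.EqOn γ (ext φ) (Set.Icc 0 D) := fun r hr ↦ by
    simp only [ext, Set.projIcc_of_mem hD hr, h]
  have hlift {γ : ℝ → P} (hγ : Spliced S 0 D γ) : ∃ φ ∈ Z, ∀ r, φ r = γ r := by
    have hlip : LipschitzWith 1 fun r : Set.Icc (0 : ℝ) D ↦ γ r := by
      refine LipschitzWith.of_dist_le_mul fun r s ↦ ?_
      have h := hγ.dist_le hS le_rfl le_rfl
      rw [NNReal.coe_one, one_mul, Subtype.dist_eq, Real.dist_eq]
      rcases le_total (r : ℝ) s with hrs | hrs
      · rw [abs_sub_comm]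
        exact (h r s r.2.1 hrs s.2.2).trans (le_abs_self _)
      · rw [dist_comm]
        exact (h s r s.2.1 hrs r.2.2).trans (le_abs_self _)
    exact ⟨⟨_, hlip.continuous⟩, ⟨γ, hγ, fun _ ↦ rfl⟩, fun _ ↦ rfl⟩
  have hZlip {φ} (hφ : φ ∈ closure Z) (r s : Set.Icc (0 : ℝ) D) (hrs : (r : ℝ) ≤ s) :
      dist (φ r) (φ s) ≤ s - r := by
    have hcl : IsClosed {φ : C(Set.Icc (0 : ℝ) D, P) | dist (φ r) (φ s) ≤ s - r} :=
      isClosed_le (by fun_prop) continuous_const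
    refine closure_minimal (fun φ hφ ↦ ?_) hcl hφ
    obtain ⟨γ, hγ, h⟩ := hφ
    rw [Set.mem_ofPred_eq, h, h]
    exact hγ.dist_le hS le_rfl le_rfl r s r.2.1 hrs s.2.2
  have : CompleteSpace (closure Z) := isClosed_closure.completeSpace_coe
  let V (n : ℕ) : Set (closure Z) := {φ | Zigzag (1 / ((n : ℝ) + 1)) (f ∘ ext φ) 0 D κ'}
  have hdense (n : ℕ) : Dense (interior (V n)) := by
    rw [Metric.dense_iff]
    intro φ₀ ε hε
    obtain ⟨φ₁, ⟨γ₁, hγ₁, h₁⟩, hd₁⟩ := Metric.mem_closure_iff.1 φ₀.2 (ε / 2) (by positivity)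
    -- The refinement moves the curve by at most 2δ ≤ ε/4, which fits in the ε/2 left over.
    set δ := min (ε / 8) (1 / ((n : ℝ) + 1)) with hδ
    have hδ0 : 0 < δ := lt_min (by positivity) (by positivity)
    obtain ⟨γ₂, hγ₂, -, -, hd₂, hz⟩ := hγ₁.hasZigzagRefinement hS hR le_rfl le_rfl hδ0
    obtain ⟨φ₂, hφ₂, h₂⟩ := hlift hγ₂
    have hd : dist φ₁ φ₂ ≤ ε / 4 := by
      refine (ContinuousMap.dist_le (by positivity)).2 fun r ↦ ?_
      rw [h₁, h₂]
      have := hd₂ r r.2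
      have := min_le_left (ε / 8) (1 / ((n : ℝ) + 1))
      linarith
    refine ⟨⟨φ₂, subset_closure hφ₂⟩, ?_, ?_⟩
    · rw [Metric.mem_ball, Subtype.dist_eq, dist_comm]
      have := dist_triangle (φ₀ : C(Set.Icc (0 : ℝ) D, P)) φ₁ φ₂
      simp only
      linarith
    · have hz' := (hz.mono (min_le_right _ _)).congr (G := f ∘ ext φ₂)
        fun r hr ↦ congrArg f (hext h₂ hr)
      rw [sub_zero] at hz'
      -- The gap between κ' and κ * D pays for the perturbation.
      obtain ⟨ρ, hρ, hρz⟩ := hz'.exists_perturb (κ * D - κ') (by linarith)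
      obtain ⟨θ, hθ, hθf⟩ := Metric.uniformContinuous_iff.1 hf ρ hρ
      refine mem_interior_iff_mem_nhds.2 (Metric.mem_nhds_iff.2 ⟨θ, hθ, fun φ hφ ↦ ?_⟩)
      have := hρz (f ∘ ext φ) fun r _ ↦ by
        rw [← dist_eq_norm]
        refine (hθf (lt_of_le_of_lt (ContinuousMap.dist_apply_le_dist _) ?_)).le
        rw [dist_comm]
        exact hφ
      rwa [sub_sub_cancel] at this
  obtain ⟨η, hη⟩ := hne
  obtain ⟨φ₀, hφ₀, -⟩ := hlift (.single hD hη fun _ _ ↦ rfl)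
  have : Nonempty (closure Z) := ⟨⟨φ₀, subset_closure hφ₀⟩⟩
  obtain ⟨φ, hφ⟩ := (dense_iInter_of_isOpen_nat (fun n ↦ isOpen_interior) hdense).nonempty
  refine ⟨ext φ, fun r s hr hrs hs ↦ ?_, fun δ hδ ↦ ?_⟩
  · have := hZlip φ.2 ⟨r, hr, hrs.trans hs⟩ ⟨s, hr.trans hrs, hs⟩ hrs
    have er := Set.projIcc_of_mem hD (Set.mem_Icc.2 ⟨hr, hrs.trans hs⟩)
    have es := Set.projIcc_of_mem hD (Set.mem_Icc.2 ⟨hr.trans hrs, hs⟩)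
    simpa only [ext, er, es] using this
  · obtain ⟨n, hn⟩ := exists_nat_one_div_lt hδ
    exact (interior_subset (Set.mem_iInter.1 hφ n) : φ ∈ V n).mono hn.le

end Baire

/-! ### Geodesics and thick families -/

namespace Geodesic

variable {P : Type*} [MetricSpace P] {u v : P}

/-- A geodesic as a curve defined on the whole real line, constant outside of `[0, d(u, v)]`. -/
noncomputable def extend (γ : Geodesic u v) : ℝ → P := Set.IccExtend dist_nonneg γ.toFun

lemma extend_coe (γ : Geodesic u v) (r : Set.Icc (0 : ℝ) (dist u v)) :
    γ.extend r = γ.toFun r := Set.IccExtend_val _ _ _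

lemma dist_toFun_of_le (γ : Geodesic u v) {r s : Set.Icc (0 : ℝ) (dist u v)} (h : r ≤ s) :
    dist (γ.toFun r) (γ.toFun s) = s - r := by
  rw [γ.isometry.dist_eq, Subtype.dist_eq, dist_comm, Real.dist_eq, abs_of_nonneg]
  exact sub_nonneg.2 h

lemma dist_source_toFun (γ : Geodesic u v) (r : Set.Icc (0 : ℝ) (dist u v)) :
    dist u (γ.toFun r) = r := by
  have h := γ.dist_toFun_of_le (r := ⟨0, le_rfl, dist_nonneg⟩) (s := r) r.2.1
  rwa [γ.source, sub_zero] at h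

lemma eq_of_toFun_eq {γ γ' : Geodesic u v} {r s : Set.Icc (0 : ℝ) (dist u v)}
    (h : γ.toFun r = γ'.toFun s) : r = s :=
  Subtype.ext (by rw [← γ.dist_source_toFun, h, γ'.dist_source_toFun])

end Geodesic

lemma IsThickFamily.zigzagReplacement {P : Type*} [MetricSpace P] {u v : P}
    {M : Set (Geodesic u v)} {c : ℝ} (hM : IsThickFamily M c) {Y : Type*} [NormedAddCommGroup Y]
    [NormedSpace ℝ Y] {f : P → Y} {α : ℝ} (hα : 0 ≤ α)
    (hf : ∀ p q, α * dist p q ≤ dist (f p) (f q)) :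
    ZigzagReplacement (Geodesic.extend '' M) f (α * c / 2) (dist u v) := by
  rintro _ ⟨γ, hγ, rfl⟩ a b ha hab hb
  have ha' : a ∈ Set.Icc 0 (dist u v) := ⟨ha, hab.le.trans hb⟩
  have hb' : b ∈ Set.Icc 0 (dist u v) := ⟨ha.trans hab.le, hb⟩
  obtain ⟨n, w, z, z', hw0, hwn, -, ⟨η, hη, σ, τ, hσ, hτ, hord⟩, ⟨η', hη', σ', τ', hσ', hτ', hord'⟩,
    hdist, hsum⟩ := hM γ hγ ⟨a, ha'⟩ ⟨b, hb'⟩ hab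
  -- The parameter of a point is its distance from u, hence the same on every geodesic through it.
  -- Together with the equal distances to w_{i-1}, this also places z_i and z̃_i at one parameter.
  obtain rfl : σ = σ' := funext fun i ↦ Geodesic.eq_of_toFun_eq ((hσ i).trans (hσ' i).symm)
  obtain rfl : τ = τ' := funext fun i ↦ by
    have h := (hdist i).2
    rw [← hσ i.castSucc, ← hτ, η.dist_toFun_of_le (hord i).1, hσ, ← hσ' i.castSucc, ← hτ',
      η'.dist_toFun_of_le (hord' i).1] at h
    exact Subtype.ext (by linarith)
  have h0 : σ 0 = ⟨a, ha'⟩ := Geodesic.eq_of_toFun_eq ((hσ 0).trans hw0)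
  have hn : σ (Fin.last n) = ⟨b, hb'⟩ :=
    Geodesic.eq_of_toFun_eq ((hσ _).trans hwn)
  rw [γ.dist_toFun_of_le (Subtype.mk_le_mk.2 hab.le)] at hsum
  have hz (θ : Geodesic u v) : Zigzag (b - a) (f ∘ θ.extend) a b
      (∑ i : Fin n, ‖chordDeviation (f ∘ θ.extend) (σ i.castSucc) (τ i) (σ i.succ)‖) := by
    have := Zigzag.of_chain (F := f ∘ θ.extend) (δ := b - a) (σ := fun i ↦ (σ i : ℝ))
      (τ := fun i ↦ (τ i : ℝ)) hord (by simp [h0, hn])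
    simpa only [h0, hn] using this
  have hend (θ : Geodesic u v) (hθ : ∀ i, θ.toFun (σ i) = w i) :
      θ.extend a = γ.extend a ∧ θ.extend b = γ.extend b := by
    have e1 := hθ 0
    have e2 := hθ (Fin.last n)
    rw [h0, hw0, ← θ.extend_coe, ← γ.extend_coe] at e1
    rw [hn, hwn, ← θ.extend_coe, ← γ.extend_coe] at e2
    exact ⟨e1, e2⟩
  have hdev (i : Fin n) : α * dist (z i) (z' i) ≤
      ‖chordDeviation (f ∘ η.extend) (σ i.castSucc) (τ i) (σ i.succ)‖ +
      ‖chordDeviation (f ∘ η'.extend) (σ i.castSucc) (τ i) (σ i.succ)‖ := by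
    -- The two chords coincide, so they cancel in the difference of the deviations.
    refine (hf _ _).trans (le_trans (le_of_eq ?_) (norm_sub_le _ _))
    simp only [chordDeviation, Function.comp_apply, Geodesic.extend_coe, hσ, hτ, hσ', hτ']
    rw [dist_eq_norm]
    congr 1
    abel
  have htot := Finset.sum_le_sum fun i (_ : i ∈ Finset.univ) ↦ hdev i
  rw [← Finset.mul_sum, Finset.sum_add_distrib] at htot
  have hsum' := mul_le_mul_of_nonneg_left hsum hα
  simp only at hsum'
  rcases le_total (∑ i : Fin n, ‖chordDeviation (f ∘ η.extend) (σ i.castSucc) (τ i) (σ i.succ)‖)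
    (∑ i : Fin n, ‖chordDeviation (f ∘ η'.extend) (σ i.castSucc) (τ i) (σ i.succ)‖) with h | h
  · exact ⟨η'.extend, ⟨η', hη', rfl⟩, (hend η' hσ').1, (hend η' hσ').2,
      (hz η').of_le (by linarith)⟩
  · exact ⟨η.extend, ⟨η, hη, rfl⟩, (hend η hσ).1, (hend η hσ).2, (hz η).of_le (by linarith)⟩

lemma Geodesic.subsingleton_of_dist_eq_zero {P : Type*} [MetricSpace P] {u v : P}
    (h : dist u v = 0) : Subsingleton (Geodesic u v) := by
  refine ⟨fun γ γ' ↦ ?_⟩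
  have hfun : γ.toFun = γ'.toFun := funext fun r ↦ by
    have hr : r = ⟨0, le_rfl, dist_nonneg⟩ := Subtype.ext (le_antisymm (r.2.2.trans h.le) r.2.1)
    rw [hr, γ.source, γ'.source]
  cases γ; cases γ'; simpa using hfun

/-! ### The main theorem -/

theorem theorem4p1 {X : Type x} [MetricSpace X] (u v : X)
    (M : Set (Geodesic (u : UniformSpace.Completion X) (v : UniformSpace.Completion X)))
    (hM : M.Infinite) (c : ℝ) (hc : 0 < c) (hthick : IsThickFamily M c)
    (Y : Type y) [NormedAddCommGroup Y] [NormedSpace ℝ Y] [CompleteSpace Y]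
    (hY : HasRNP.{w} Y) :
    ¬ ∃ f : X → Y, IsBilipschitzEmbedding f := by
  rintro ⟨f, α, β, hα, hβ, hf⟩
  have hlip : LipschitzWith β.toNNReal f := LipschitzWith.of_dist_le_mul fun p q ↦ by
    rw [Real.coe_toNNReal _ hβ.le]; exact (hf p q).2
  set g := UniformSpace.Completion.extension f with hg
  have hgc : Continuous g := UniformSpace.Completion.continuous_extension
  have hgf (p : X) : g p = f p :=
    UniformSpace.Completion.extension_coe hlip.uniformContinuous p
  have hlow (p q : UniformSpace.Completion X) : α * dist p q ≤ dist (g p) (g q) := by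
    induction p, q using UniformSpace.Completion.induction_on₂ with
    | hp => exact isClosed_le (by fun_prop) (by fun_prop)
    | ih p q => rw [hgf, hgf, UniformSpace.Completion.dist_eq]; exact (hf p q).1
  have hup (p q : UniformSpace.Completion X) : dist (g p) (g q) ≤ β * dist p q := by
    induction p, q using UniformSpace.Completion.induction_on₂ with
    | hp => exact isClosed_le (by fun_prop) (by fun_prop)
    | ih p q => rw [hgf, hgf, UniformSpace.Completion.dist_eq]; exact (hf p q).2
  set D := dist (u : UniformSpace.Completion X) v with hD
  -- If u = v, thickness is vacuous; the infinitude of M rules this out.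
  have hD0 : 0 < D := by
    refine dist_nonneg.lt_of_ne' fun h ↦ hM ?_
    have := Geodesic.subsingleton_of_dist_eq_zero h
    exact M.toFinite
  have hκ : 0 < α * c / 2 * D := by positivity
  obtain ⟨γ, hγ, hz⟩ := exists_curve_zigzag (κ' := α * c / 2 * D / 2)
    (UniformSpace.Completion.uniformContinuous_extension (f := f)) hD0.le (by
      rintro _ ⟨γ, -, rfl⟩ r s hr hrs hs
      have h := γ.dist_toFun_of_le (r := ⟨r, hr, hrs.trans hs⟩) (s := ⟨s, hr.trans hrs, hs⟩) hrs
      rw [← γ.extend_coe, ← γ.extend_coe] at h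
      exact h.le) (hthick.zigzagReplacement hα.le hlow) (hM.nonempty.image _) (by linarith)
  obtain ⟨δ, hδ, hδz⟩ := hY.exists_not_zigzag (F := g ∘ γ) (L := β) hD0 (half_pos hκ)
    fun s t hs hst ht ↦ by
      rw [← dist_eq_norm, dist_comm]
      exact (hup _ _).trans (mul_le_mul_of_nonneg_left (hγ s t hs hst ht) hβ.le)
  exact hδz (hz δ hδ)
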